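/- Let $n$ users share a battery of capacity $b_{\max}\in\mathbb{N}$. Their net generation $X(t)=(X_1(t),\dots,X_n(t))$ is an irreducible discrete-time Markov chain on a finite set $S\subseteq\prod_{i=1}^n S_i$, where each $S_i\subset\mathbb{Z}$ is finite and contains a positive and a negative element, and $\mathbb{P}(X(t+1)=s\mid X(t)=s)>0$ for all $s\in S$. Let $\pi$ be its stationary distribution, let $\Delta_i=\sum_{s\in S}s_i\,\pi(s)$ be the drift of user $i$ and $\Delta=\sum_{i=1}^n\Delta_i$ the system drift. In a state $(x,b)\in S\times\{0,\dots,b_{\max}\}$ the allowable actions are the vectors $a\in\mathbb{Z}^n$ with $0\le a_i\le x_i$ if $x_i\ge 0$, $x_i\le a_i\le 0$ if $x_i<0$, and $0\le b+\sum_i a_i\le b_{\max}$; the battery occupancy evolves by $B(t+1)=B(t)+\sum_i A_i(t)$. A policy $\phi$ is randomized and history-dependent: at each time $t$ it maps the history $(X(s),B(s))_{s\le t}$ to a probability distribution on the allowable actions in the current state. For each $b_{\max}$ fix an arbitrary initial distribution of $(X(0),B(0))$. The loss of load rate of $\phi$ is $$\mathrm{LLR}(\phi)=\lim_{T\to\infty}\frac1T\sum_{t=0}^{T}\sum_{i=1}^n\mathbb{E}\bigl[\mathbf{1}\{X_i(t)<0\}\,(A_i(t)-X_i(t))\bigr],$$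 and $\phi$ is fair if $\lim_{T\to\infty}\frac1T\sum_{t=0}^{T}\mathbb{E}[A_i(t)]\ge 0$ for every user $i$ (where these limits do not exist, the first is read as $\limsup$ and the second as $\liminf$). Let $\mathrm{LLR}_o$ be the infimum of $\mathrm{LLR}(\phi)$ over all fair policies, $\mathrm{LLR}_e$ its infimum over all policies, and $\mathrm{PoF}=\mathrm{LLR}_o/\mathrm{LLR}_e\in[0,\infty]$ the price of fairness, with $c/0=\infty$ for $c>0$. Suppose that at least one user is net demanding, that is, $\Delta_i<0$ for some $i$, but the system is net generative, that is, $\Delta>0$. Then $$\mathrm{PoF}\to\infty\quad\text{as } b_{\max}\to\infty.$$ Moreover, $\mathrm{LLR}_o\ge\sum_{i:\Delta_i<0}(-\Delta_i)>0$ for every $b_{\max}$, and $\mathrm{LLR}_e\to 0$ as $b_{\max}\to\infty$. -/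

import Mathlib

open Filter Topology
open scoped ENNReal

noncomputable section

namespace BatterySharing

/-- The net generation of `n` users: an irreducible discrete time Markov chain on a finite set
`states` of integer vectors. `userStates i` is the set of values allowed for user `i`; it contains
a positive and a negative value. Every state is kept with positive probability. -/
structure NetGeneration (n : ℕ) where
  userStates : Fin n → Finset ℤ
  states : Finset (Fin n → ℤ)
  states_subset : states ⊆ Fintype.piFinset userStates
  exists_pos : ∀ i, ∃ s ∈ userStates i, 0 < s
  exists_neg : ∀ i, ∃ s ∈ userStates i, s < 0
  /-- `trans s s'` is the probability of moving from `s` to `s'` in one step. -/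
  trans : states → PMF states
  irreducible : (Matrix.of fun s s' : states => (trans s s').toReal).IsIrreducible
  self_pos : ∀ s, 0 < trans s s

variable {n : ℕ}

namespace NetGeneration

/-- `π` is a stationary distribution of the chain. -/
def IsStationary (G : NetGeneration n) (π : PMF G.states) : Prop :=
  π.bind G.trans = π

/-- The drift `Δ_i` of user `i` with respect to the (stationary) distribution `π`. -/
def drift (G : NetGeneration n) (π : PMF G.states) (i : Fin n) : ℝ :=
  ∑ s : G.states, (s.1 i : ℝ) * (π s).toReal

/-- The system drift `Δ`. -/
def systemDrift (G : NetGeneration n) (π : PMF G.states) : ℝ :=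
  ∑ i, G.drift π i

/-- The states `(x, b)` of the controlled process for battery size `bmax`: net generation vector
and battery occupancy `0 ≤ b ≤ bmax`. -/
abbrev State (G : NetGeneration n) (bmax : ℕ) : Type :=
  G.states × Fin (bmax + 1)

/-- The histories `(X(s), B(s))`, `s ≤ t`. -/
abbrev History (G : NetGeneration n) (bmax t : ℕ) : Type :=
  Fin (t + 1) → G.State bmax

end NetGeneration

/-- The allowable actions when the net generation is `x`, the battery occupancy is `b` and the
battery size is `bmax`: `a i` is the energy accepted from (or, if negative, supplied to) user
`i`. -/
def allowed (bmax : ℕ) (x : Fin n → ℤ) (b : ℕ) : Finset (Fin n → ℤ) :=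
  (Fintype.piFinset fun i =>
      if 0 ≤ x i then Finset.Icc 0 (x i) else Finset.Icc (x i) 0).filter
    fun a => 0 ≤ (b : ℤ) + ∑ i, a i ∧ (b : ℤ) + ∑ i, a i ≤ (bmax : ℤ)

/-- The demand left unmet when action `a` is taken at net generation `x`, summed over users. -/
def loss (x a : Fin n → ℤ) : ℤ :=
  ∑ i, if x i < 0 then a i - x i else 0

namespace NetGeneration

/-- The actions available in a state of the controlled process. -/
abbrev Action (G : NetGeneration n) {bmax : ℕ} (σ : G.State bmax) : Type :=
  allowed bmax σ.1.1 σ.2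

/-- A randomized, history-dependent policy: at each time it maps the history so far to a
probability distribution on the actions available in the current state. -/
abbrev Policy (G : NetGeneration n) (bmax : ℕ) : Type :=
  (t : ℕ) → (h : G.History bmax t) → PMF (G.Action (h (Fin.last t)))

/-- Battery dynamics: `B(t+1) = B(t) + ∑ i, A_i(t)`. -/
def nextBattery (G : NetGeneration n) {bmax : ℕ} (σ : G.State bmax) (a : G.Action σ) :
    Fin (bmax + 1) :=
  ⟨((σ.2 : ℤ) + ∑ i, a.1 i).toNat, by
    have h := (Finset.mem_filter.1 a.2).2
    omega⟩

/-- The law of the history up to time `t` under the policy `φ` and the initial distribution `ν`: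
the action is drawn from `φ`, and the net generation moves according to its own chain. -/
def law (G : NetGeneration n) {bmax : ℕ} (ν : PMF (G.State bmax)) (φ : G.Policy bmax) :
    (t : ℕ) → PMF (G.History bmax t)
  | 0 => ν.map fun σ _ => σ
  | t + 1 => (law G ν φ t).bind fun h =>
      (φ t h).bind fun a =>
        (G.trans (h (Fin.last t)).1).map fun x' =>
          Fin.snoc (α := fun _ => G.State bmax) h (x', G.nextBattery (h (Fin.last t)) a)

/-- The expectation `𝔼[f(X(t), A(t))]`. -/
def expect (G : NetGeneration n) {bmax : ℕ} (ν : PMF (G.State bmax)) (φ : G.Policy bmax)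
    (f : (Fin n → ℤ) → (Fin n → ℤ) → ℝ) (t : ℕ) : ℝ :=
  ∑ h : G.History bmax t, (G.law ν φ t h).toReal *
    ∑ a : G.Action (h (Fin.last t)), (φ t h a).toReal * f (h (Fin.last t)).1.1 a.1

/-- The time average `(1/T) ∑_{t=0}^T 𝔼[f(X(t), A(t))]`. -/
def timeAverage (G : NetGeneration n) {bmax : ℕ} (ν : PMF (G.State bmax)) (φ : G.Policy bmax)
    (f : (Fin n → ℤ) → (Fin n → ℤ) → ℝ) (T : ℕ) : ℝ :=
  (1 / (T : ℝ)) * ∑ t ∈ Finset.range (T + 1), G.expect ν φ f t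

/-- The loss of load rate of the system under `φ`. It is the limit of the time averages of the
expected unmet demand; for policies for which this limit does not exist, the upper limit. -/
def LLR (G : NetGeneration n) {bmax : ℕ} (ν : PMF (G.State bmax)) (φ : G.Policy bmax) : ℝ≥0∞ :=
  limsup (fun T => ENNReal.ofReal (G.timeAverage ν φ (fun x a => (loss x a : ℝ)) T)) atTop

/-- The fairness constraints: every user's long-run average net contribution to the battery is
nonnegative (the limit, or the lower limit where the limit does not exist). -/
def IsFair (G : NetGeneration n) {bmax : ℕ} (ν : PMF (G.State bmax)) (φ : G.Policy bmax) : Prop :=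
  ∀ i : Fin n,
    (0 : EReal) ≤ liminf (fun T => (G.timeAverage ν φ (fun _ a => (a i : ℝ)) T : EReal)) atTop

/-- The optimal loss of load rate over fair policies. -/
def LLRo (G : NetGeneration n) {bmax : ℕ} (ν : PMF (G.State bmax)) : ℝ≥0∞ :=
  ⨅ (φ : G.Policy bmax) (_ : G.IsFair ν φ), G.LLR ν φ

/-- The optimal loss of load rate over all policies. -/
def LLRe (G : NetGeneration n) {bmax : ℕ} (ν : PMF (G.State bmax)) : ℝ≥0∞ :=
  ⨅ φ : G.Policy bmax, G.LLR ν φ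

/-- The price of fairness, with the convention `c / 0 = ∞` for `c > 0`. -/
def PoF (G : NetGeneration n) {bmax : ℕ} (ν : PMF (G.State bmax)) : ℝ≥0∞ :=
  G.LLRo ν / G.LLRe ν

end NetGeneration

end BatterySharing

end

/-!
The state of the controlled process is followed through the Poisson equation of the net
generation: for every function `f` of the net generation there is a `g` with
`f - π f = g - P g` (`exists_poisson`). It exists because the chain is irreducible and finite, so
that `1 - P` has range exactly `ker π`. Summed along a trajectory the equation telescopes, which
gives `tendsto_average_of_states`: time averages of `f` converge to `π f` whatever the policy.

*Fair policies lose load.* The loss of user `i` is nonnegative and at least `A_i - X_i`. For a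
fair policy the average of `A_i` is asymptotically nonnegative, and that of `X_i` converges to
`Δ_i`; summing over the net demanding users gives the lower bound `∑ -Δ_i`
(`le_LLR_of_isFair`), which does not depend on the battery.

*Without fairness the loss vanishes.* Consider the policy that serves and accepts everything
whenever this is possible, does nothing when the demand exceeds the stored energy, and serves all
demand but accepts nothing when the battery would overflow. Let `Z` be the free space of the
battery corrected by the solution `g` of the Poisson equation for the total net generation
(`freeSpace`). Away from the full battery `Z` has drift at most `-Δ < 0`, and near the full battery
it is bounded, so `E[Z'² | state] ≤ Z² - 2 Δ Z + K` with `K` independent of the capacity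
(`mean_freeSpace_sq_le`). Hence the long-run average of `Z` is bounded independently of the
capacity. Load is lost only when the battery is nearly empty, that is, when `Z` is of the order of
`bmax`, and Markov's inequality bounds the loss of load rate by a constant over `bmax`
(`exists_LLRe_le`). The price of fairness is at least the quotient of a positive constant and this
bound.
-/

namespace BatterySharing

/-! ### Expectations on finite types -/

/-- The expectation of a real function under a probability distribution on a finite type, as a
finite sum. -/
noncomputable def mean {α : Type*} [Fintype α] (p : PMF α) (f : α → ℝ) : ℝ :=
  ∑ a, (p a).toReal * f a

section Mean

variable {α β : Type*} [Fintype α] [Fintype β]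

lemma sum_toReal (p : PMF α) : ∑ a, (p a).toReal = 1 := by
  have h := p.tsum_coe
  rw [tsum_fintype] at h
  rw [← ENNReal.toReal_sum fun a _ => p.apply_ne_top a, h, ENNReal.toReal_one]

lemma mean_const (p : PMF α) (c : ℝ) : mean p (fun _ => c) = c := by
  simp [mean, ← Finset.sum_mul, sum_toReal]

lemma mean_add (p : PMF α) (f g : α → ℝ) :
    mean p (fun a => f a + g a) = mean p f + mean p g := by
  simp [mean, mul_add, Finset.sum_add_distrib]

lemma mean_sub (p : PMF α) (f g : α → ℝ) :
    mean p (fun a => f a - g a) = mean p f - mean p g := by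
  simp [mean, mul_sub, Finset.sum_sub_distrib]

lemma mean_const_mul (p : PMF α) (c : ℝ) (f : α → ℝ) :
    mean p (fun a => c * f a) = c * mean p f := by
  simp only [mean, Finset.mul_sum]
  exact Finset.sum_congr rfl fun a _ => by ring

lemma mean_sum {ι : Type*} (p : PMF α) (s : Finset ι) (f : ι → α → ℝ) :
    mean p (fun a => ∑ i ∈ s, f i a) = ∑ i ∈ s, mean p (f i) := by
  simp only [mean, Finset.mul_sum]
  exact Finset.sum_comm

lemma mean_mono (p : PMF α) {f g : α → ℝ} (h : ∀ a, f a ≤ g a) : mean p f ≤ mean p g :=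
  Finset.sum_le_sum fun a _ => mul_le_mul_of_nonneg_left (h a) ENNReal.toReal_nonneg

lemma mean_le_of_le (p : PMF α) {f : α → ℝ} {c : ℝ} (h : ∀ a, f a ≤ c) : mean p f ≤ c :=
  (mean_mono p h).trans_eq (mean_const p c)

lemma le_mean_of_le (p : PMF α) {f : α → ℝ} {c : ℝ} (h : ∀ a, c ≤ f a) : c ≤ mean p f :=
  (mean_const p c).symm.trans_le (mean_mono p h)

lemma mean_pure (a : α) (f : α → ℝ) : mean (PMF.pure a) f = f a := by
  classical
  simp [mean, PMF.pure_apply, apply_ite ENNReal.toReal]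

lemma mean_bind (p : PMF α) (q : α → PMF β) (f : β → ℝ) :
    mean (p.bind q) f = mean p fun a => mean (q a) f := by
  have h : ∀ b, (p.bind q b).toReal = ∑ a, (p a).toReal * (q a b).toReal := fun b => by
    rw [PMF.bind_apply, tsum_fintype, ENNReal.toReal_sum fun a _ =>
      ENNReal.mul_ne_top (p.apply_ne_top a) ((q a).apply_ne_top b)]
    simp
  simp only [mean, h, Finset.sum_mul, Finset.mul_sum]
  rw [Finset.sum_comm]
  exact Finset.sum_congr rfl fun a _ => Finset.sum_congr rfl fun b _ => by ring

lemma mean_map (p : PMF α) (g : α → β) (f : β → ℝ) :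
    mean (p.map g) f = mean p fun a => f (g a) := by
  rw [← PMF.bind_pure_comp, mean_bind]
  simp [mean_pure]

end Mean

/-! ### The Poisson equation of an irreducible finite chain -/

section Poisson

variable {S : Type*} [Fintype S]

/-- The operator `f ↦ f - P f` of a finite Markov chain with transition kernel `κ`. -/
noncomputable def oneSubKernel (κ : S → PMF S) : (S → ℝ) →ₗ[ℝ] (S → ℝ) where
  toFun f s := f s - mean (κ s) f
  map_add' f g := by
    funext s
    have := mean_add (κ s) f g
    simp only [Pi.add_apply, Pi.add_def] at this ⊢
    linarith
  map_smul' c f := by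
    funext s
    have := mean_const_mul (κ s) c f
    simp only [Pi.smul_apply, Pi.smul_def, smul_eq_mul, RingHom.id_apply] at this ⊢
    rw [this]; ring

lemma eq_of_harmonic {κ : S → PMF S}
    (hκ : (Matrix.of fun s s' : S => (κ s s').toReal).IsIrreducible)
    {f : S → ℝ} (hf : ∀ s, mean (κ s) f = f s) (s t : S) : f s = f t := by
  classical
  set A : Matrix S S ℝ := Matrix.of fun s s' : S => (κ s s').toReal with hA
  have hpos := (Matrix.isIrreducible_iff_exists_pow_pos hκ.nonneg).1 hκ
  have hpow : ∀ (g : S → ℝ), A.mulVec g = g → ∀ k, (A ^ k).mulVec g = g := by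
    intro g hg k
    induction k with
    | zero => simp
    | succ k ih => rw [pow_succ, ← Matrix.mulVec_mulVec, hg, ih]
  have hAf : A.mulVec f = f := funext hf
  have hA1 : A.mulVec (fun _ => 1) = fun _ => 1 := funext fun s => mean_const (κ s) 1
  have : Nonempty S := ⟨s⟩
  -- a maximum point of `f` averages `f` with positive weight on every other state
  obtain ⟨m, hm⟩ := Finite.exists_max f
  have key : ∀ j, f j = f m := by
    intro j
    obtain ⟨k, -, hk⟩ := hpos m j
    have h1 := congrFun (hpow f hAf k) m
    have h2 := congrFun (hpow _ hA1 k) m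
    simp only [Matrix.mulVec, dotProduct, mul_one] at h1 h2
    have h3 : ∑ i, (A ^ k) m i * (f m - f i) = 0 := by
      simp only [mul_sub, Finset.sum_sub_distrib, ← Finset.sum_mul, h1, h2]; ring
    have hnn : ∀ i j, 0 ≤ (A ^ k) i j := Matrix.pow_apply_nonneg hκ.nonneg k
    rw [Finset.sum_eq_zero_iff_of_nonneg fun i _ =>
      mul_nonneg (hnn m i) (sub_nonneg.2 (hm i))] at h3
    have h4 := h3 j (Finset.mem_univ j)
    rcases mul_eq_zero.1 h4 with h | h
    · exact absurd h hk.ne'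
    · linarith
  rw [key s, key t]

/-- The Poisson equation. The range of `1 - P` lies in the kernel of `π`, and both have
codimension one: harmonic functions are constant by irreducibility, and `π ≠ 0`. -/
lemma exists_poisson {κ : S → PMF S}
    (hκ : (Matrix.of fun s s' : S => (κ s s').toReal).IsIrreducible)
    {π : PMF S} (hπ : π.bind κ = π) (f : S → ℝ) :
    ∃ g : S → ℝ, ∀ s, mean (κ s) g = g s - (f s - mean π f) := by
  let L := oneSubKernel κ
  let ℓ : (S → ℝ) →ₗ[ℝ] ℝ :=
    { toFun := mean π
      map_add' := mean_add π
      map_smul' := mean_const_mul π }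
  obtain ⟨s₀, -⟩ := π.support_nonempty
  have : Nonempty S := ⟨s₀⟩
  have hle : LinearMap.range L ≤ LinearMap.ker ℓ := by
    rintro _ ⟨g, rfl⟩
    rw [LinearMap.mem_ker]
    change mean π (fun s => g s - mean (κ s) g) = 0
    rw [mean_sub, ← mean_bind, hπ, sub_self]
  have hker : Module.finrank ℝ (LinearMap.ker L) ≤ 1 := by
    have : LinearMap.ker L ≤ Submodule.span ℝ {fun _ => (1 : ℝ)} := by
      intro g hg
      rw [Submodule.mem_span_singleton]
      refine ⟨g s₀, funext fun s => ?_⟩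
      have hh : ∀ s, mean (κ s) g = g s := fun s => by
        have h : g s - mean (κ s) g = 0 := congrFun (LinearMap.mem_ker.1 hg) s
        linarith
      simpa using eq_of_harmonic hκ hh s₀ s
    exact (Submodule.finrank_mono this).trans ((finrank_span_le_card _).trans (by simp))
  have hsurj : LinearMap.range ℓ = ⊤ :=
    LinearMap.range_eq_top.2 fun c => ⟨fun _ => c, mean_const π c⟩
  have h1 := L.finrank_range_add_finrank_ker
  have h2 := ℓ.finrank_range_add_finrank_ker
  rw [hsurj, finrank_top, Module.finrank_self] at h2
  have heq : LinearMap.range L = LinearMap.ker ℓ :=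
    Submodule.eq_of_le_of_finrank_le hle (by omega)
  have hmem : (fun s => f s - mean π f) ∈ LinearMap.ker ℓ := by
    rw [LinearMap.mem_ker]
    change mean π (fun s => f s - mean π f) = 0
    rw [mean_sub, mean_const, sub_self]
  rw [← heq] at hmem
  obtain ⟨g, hg⟩ := hmem
  refine ⟨g, fun s => ?_⟩
  have h : g s - mean (κ s) g = f s - mean π f := congrFun hg s
  linarith

end Poisson

variable {n : ℕ}

/-! ### Expectations along the controlled process -/

namespace NetGeneration

variable (G : NetGeneration n) {bmax : ℕ} (ν : PMF (G.State bmax)) (φ : G.Policy bmax)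

lemma expect_eq_mean (f : (Fin n → ℤ) → (Fin n → ℤ) → ℝ) (t : ℕ) :
    G.expect ν φ f t = mean (G.law ν φ t) fun h =>
      mean (φ t h) fun a => f (h (Fin.last t)).1.1 a.1 :=
  rfl

/-- The one-step recursion for the expectation of a function of the current state. -/
lemma mean_law_succ (F : G.State bmax → ℝ) (t : ℕ) :
    mean (G.law ν φ (t + 1)) (fun h => F (h (Fin.last (t + 1)))) =
      mean (G.law ν φ t) fun h => mean (φ t h) fun a =>
        mean (G.trans (h (Fin.last t)).1) fun x' =>
          F (x', G.nextBattery (h (Fin.last t)) a) := by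
  rw [law]
  simp only [mean_bind, mean_map, Fin.snoc_last]

/-- Whatever the policy, the time averages of a function of the net generation converge to its
stationary mean. -/
lemma tendsto_average_of_states {π : PMF G.states} (hπ : G.IsStationary π) (u : G.states → ℝ) :
    Tendsto (fun T : ℕ => (1 / (T : ℝ)) * ∑ t ∈ Finset.range (T + 1),
      mean (G.law ν φ t) fun h => u (h (Fin.last t)).1) atTop (𝓝 (mean π u)) := by
  obtain ⟨g, hg⟩ := exists_poisson G.irreducible hπ u
  obtain ⟨C, hC⟩ : ∃ C, ∀ s, |g s| ≤ C := by
    obtain ⟨C, hC⟩ := (Set.finite_range fun s => |g s|).bddAbove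
    exact ⟨C, fun s => hC ⟨s, rfl⟩⟩
  set m : ℕ → ℝ := fun t => mean (G.law ν φ t) fun h => g (h (Fin.last t)).1 with hm
  have hmC : ∀ t, |m t| ≤ C := fun t => abs_le.2
    ⟨le_mean_of_le _ fun h => (abs_le.1 (hC _)).1, mean_le_of_le _ fun h => (abs_le.1 (hC _)).2⟩
  have hstep : ∀ t, m (t + 1) =
      m t - ((mean (G.law ν φ t) fun h => u (h (Fin.last t)).1) - mean π u) := by
    intro t
    simp only [hm]
    rw [G.mean_law_succ ν φ (fun σ => g σ.1)]
    simp only [mean_const, hg, mean_sub]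
  have hsum : ∀ N : ℕ, ∑ t ∈ Finset.range N, (mean (G.law ν φ t) fun h => u (h (Fin.last t)).1) =
      N * mean π u + (m 0 - m N) := by
    intro N
    induction N with
    | zero => simp
    | succ N ih =>
      rw [Finset.sum_range_succ, ih]
      have := hstep N
      push_cast
      linarith
  simp only [hsum]
  have hlim : Tendsto (fun T : ℕ => (1 / (T : ℝ)) * (mean π u + (m 0 - m (T + 1)))) atTop
      (𝓝 0) := by
    have h0 : Tendsto (fun T : ℕ => (1 / (T : ℝ)) * (|mean π u| + 2 * C)) atTop (𝓝 0) := by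
      simpa using tendsto_one_div_atTop_nhds_zero_nat.mul_const (|mean π u| + 2 * C)
    refine squeeze_zero_norm (fun T => ?_) h0
    rw [norm_mul, Real.norm_of_nonneg (by positivity : (0 : ℝ) ≤ 1 / (T : ℝ))]
    refine mul_le_mul_of_nonneg_left ?_ (by positivity)
    rw [Real.norm_eq_abs]
    have h1 := abs_add_le (mean π u) (m 0 - m (T + 1))
    have h2 := abs_sub (m 0) (m (T + 1))
    have h3 := hmC 0
    have h4 := hmC (T + 1)
    linarith
  have := hlim.const_add (mean π u)
  rw [add_zero] at this
  refine this.congr' ?_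
  filter_upwards [eventually_gt_atTop 0] with T hT
  have : (T : ℝ) ≠ 0 := by positivity
  push_cast
  field_simp
  ring

lemma timeAverage_mono {f g : (Fin n → ℤ) → (Fin n → ℤ) → ℝ}
    (h : ∀ (σ : G.State bmax) (a : G.Action σ), f σ.1.1 a.1 ≤ g σ.1.1 a.1) (T : ℕ) :
    G.timeAverage ν φ f T ≤ G.timeAverage ν φ g T :=
  mul_le_mul_of_nonneg_left
    (Finset.sum_le_sum fun _ _ => mean_mono _ fun _ => mean_mono _ fun a => h _ a)
    (by positivity)

lemma timeAverage_sum_sub (s : Finset (Fin n)) (T : ℕ) :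
    G.timeAverage ν φ (fun x a => ∑ i ∈ s, ((a i : ℝ) - x i)) T =
      ∑ i ∈ s, (G.timeAverage ν φ (fun _ a => (a i : ℝ)) T -
        G.timeAverage ν φ (fun x _ => (x i : ℝ)) T) := by
  simp only [timeAverage, expect_eq_mean, mean_sum, mean_sub]
  rw [Finset.sum_comm]
  simp only [Finset.sum_sub_distrib, Finset.mul_sum, mul_sub]

lemma drift_eq_mean (π : PMF G.states) (i : Fin n) :
    G.drift π i = mean π fun s => (s.1 i : ℝ) :=
  Finset.sum_congr rfl fun _ _ => mul_comm _ _

lemma systemDrift_eq_mean (π : PMF G.states) :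
    G.systemDrift π = mean π fun s => ∑ i, (s.1 i : ℝ) := by
  simp only [systemDrift, drift_eq_mean, mean_sum]

end NetGeneration

/-! ### Lower bound for fair policies -/

lemma mem_allowed {bmax : ℕ} {x a : Fin n → ℤ} {b : ℕ} :
    a ∈ allowed bmax x b ↔
      (∀ i, (0 ≤ x i → 0 ≤ a i ∧ a i ≤ x i) ∧ (x i < 0 → x i ≤ a i ∧ a i ≤ 0)) ∧
        0 ≤ (b : ℤ) + ∑ i, a i ∧ (b : ℤ) + ∑ i, a i ≤ (bmax : ℤ) := by
  simp only [allowed, Finset.mem_filter, Fintype.mem_piFinset]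
  refine and_congr_left fun _ => forall_congr' fun i => ?_
  split_ifs with h
  · simp [h, h.not_gt]
  · simp [h, not_le.1 h]

lemma sum_sub_le_loss {bmax : ℕ} {x a : Fin n → ℤ} {b : ℕ} (ha : a ∈ allowed bmax x b)
    (s : Finset (Fin n)) : ∑ i ∈ s, (a i - x i) ≤ loss x a := by
  have h := (mem_allowed.1 ha).1
  have hterm : ∀ i, (a i - x i ≤ if x i < 0 then a i - x i else 0) ∧
      0 ≤ if x i < 0 then a i - x i else 0 := fun i => by
    have := h i
    split_ifs <;> omega
  exact (Finset.sum_le_sum fun i _ => (hterm i).1).trans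
    (Finset.sum_le_univ_sum_of_nonneg fun i => (hterm i).2)

namespace NetGeneration

/-- A fair policy leaves at least the deficit of every net demanding user unserved: the loss of
user `i` dominates `A_i - X_i`, whose average is at least `-Δ_i` by fairness. -/
lemma le_LLR_of_isFair (G : NetGeneration n) {π : PMF G.states} (hπ : G.IsStationary π)
    {bmax : ℕ} {ν : PMF (G.State bmax)} {φ : G.Policy bmax} (hφ : G.IsFair ν φ) :
    ENNReal.ofReal (∑ i with G.drift π i < 0, -G.drift π i) ≤ G.LLR ν φ := by
  set s : Finset (Fin n) := Finset.univ.filter fun i => G.drift π i < 0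
  have hbound : ∀ ε : ℝ, 0 < ε →
      ENNReal.ofReal (∑ i ∈ s, (-ε - (G.drift π i + ε))) ≤ G.LLR ν φ := by
    intro ε hε
    have hev : ∀ᶠ T in atTop, ∀ i : Fin n,
        -ε < G.timeAverage ν φ (fun _ a => (a i : ℝ)) T ∧
          G.timeAverage ν φ (fun x _ => (x i : ℝ)) T < G.drift π i + ε := by
      rw [eventually_all]
      intro i
      have h1 : ((-ε : ℝ) : EReal) <
          liminf (fun T => (G.timeAverage ν φ (fun _ a => (a i : ℝ)) T : EReal)) atTop :=
        lt_of_lt_of_le (by exact_mod_cast neg_lt_zero.2 hε) (hφ i)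
      have h2 : Tendsto (fun T => G.timeAverage ν φ (fun x _ => (x i : ℝ)) T) atTop
          (𝓝 (G.drift π i)) := by
        have := G.tendsto_average_of_states ν φ hπ fun s => (s.1 i : ℝ)
        simpa only [timeAverage, expect_eq_mean, mean_const, drift_eq_mean] using this
      filter_upwards [eventually_lt_of_lt_liminf h1,
        h2.eventually_lt_const (lt_add_of_pos_right _ hε)] with T hT1 hT2
      exact ⟨by exact_mod_cast hT1, hT2⟩
    refine (le_liminf_of_le (by isBoundedDefault) ?_).trans
      (liminf_le_limsup (by isBoundedDefault) (by isBoundedDefault))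
    filter_upwards [hev] with T hT
    refine ENNReal.ofReal_le_ofReal ?_
    calc ∑ i ∈ s, (-ε - (G.drift π i + ε))
        ≤ ∑ i ∈ s, (G.timeAverage ν φ (fun _ a => (a i : ℝ)) T -
            G.timeAverage ν φ (fun x _ => (x i : ℝ)) T) :=
          Finset.sum_le_sum fun i _ => sub_le_sub (hT i).1.le (hT i).2.le
      _ = G.timeAverage ν φ (fun x a => ∑ i ∈ s, ((a i : ℝ) - x i)) T :=
          (G.timeAverage_sum_sub ν φ s T).symm
      _ ≤ _ := G.timeAverage_mono ν φ
          (fun σ a => by exact_mod_cast sum_sub_le_loss a.2 s) T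
  have hcont : Tendsto (fun ε : ℝ => ENNReal.ofReal (∑ i ∈ s, (-ε - (G.drift π i + ε))))
      (𝓝[>] 0) (𝓝 (ENNReal.ofReal (∑ i ∈ s, -G.drift π i))) := by
    have : Continuous fun ε : ℝ => ENNReal.ofReal (∑ i ∈ s, (-ε - (G.drift π i + ε))) :=
      ENNReal.continuous_ofReal.comp (by fun_prop)
    simpa using (this.tendsto 0).mono_left nhdsWithin_le_nhds
  exact le_of_tendsto hcont (eventually_mem_nhdsWithin.mono fun ε hε => hbound ε hε)

end NetGeneration

/-! ### A policy with small loss on large batteries -/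

lemma abs_sum_le_of_mem_allowed {bmax : ℕ} {x a : Fin n → ℤ} {b : ℕ}
    (ha : a ∈ allowed bmax x b) : |∑ i, a i| ≤ ∑ i, |x i| := by
  refine (Finset.abs_sum_le_sum_abs _ _).trans (Finset.sum_le_sum fun i _ => ?_)
  have := (mem_allowed.1 ha).1 i
  rcases abs_cases (a i) with h | h <;> rcases abs_cases (x i) with h' | h' <;> omega

lemma loss_le_of_mem_allowed {bmax : ℕ} {x a : Fin n → ℤ} {b : ℕ}
    (ha : a ∈ allowed bmax x b) : loss x a ≤ ∑ i, |x i| := by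
  refine Finset.sum_le_sum fun i _ => ?_
  have := (mem_allowed.1 ha).1 i
  rcases abs_cases (x i) with h' | h' <;> split_ifs <;> omega

lemma loss_self (x : Fin n → ℤ) : loss x x = 0 := by
  simp [loss]

/-- On a battery that is large compared to the net generation there is always an action that
loses load only near the empty battery and spills energy only near the full battery. -/
lemma exists_action {bmax M b : ℕ} {x : Fin n → ℤ} (hx : ∑ i, |x i| ≤ M) (hM : 2 * M ≤ bmax)
    (hb : b ≤ bmax) :
    ∃ a ∈ allowed bmax x b,
      (loss x a = 0 ∨ b < M) ∧ (∑ i, x i ≤ ∑ i, a i ∨ bmax ≤ b + M) := by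
  have hS := abs_le.1 ((Finset.abs_sum_le_sum_abs x Finset.univ).trans hx)
  by_cases h1 : (b : ℤ) + ∑ i, x i < 0
  -- the demand exceeds the stored energy: do nothing
  · refine ⟨0, mem_allowed.2 ⟨fun i => ?_, ?_⟩, Or.inr (by omega), Or.inl ?_⟩
    · simp only [Pi.zero_apply]; omega
    · simp only [Pi.zero_apply, Finset.sum_const_zero]; omega
    · simp only [Pi.zero_apply, Finset.sum_const_zero]; omega
  by_cases h2 : (b : ℤ) + ∑ i, x i ≤ bmax
  · exact ⟨x, mem_allowed.2 ⟨fun i => by omega, by omega⟩, Or.inl (loss_self x), Or.inl le_rfl⟩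
  -- the battery would overflow: serve all demand and accept nothing
  · have hlo : -(M : ℤ) ≤ ∑ i, min (x i) 0 := by
      have : ∑ i, -|x i| ≤ ∑ i, min (x i) 0 := Finset.sum_le_sum fun i _ => by
        rcases abs_cases (x i) with h | h <;> omega
      rw [Finset.sum_neg_distrib] at this
      omega
    have hhi : ∑ i, min (x i) 0 ≤ 0 := Finset.sum_nonpos fun i _ => min_le_right _ _
    refine ⟨fun i => min (x i) 0, mem_allowed.2 ⟨fun i => by omega, by omega⟩, Or.inl ?_,
      Or.inr (by omega)⟩
    refine Finset.sum_eq_zero fun i _ => ?_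
    split_ifs with h
    · simp [min_eq_left h.le]
    · rfl

namespace NetGeneration

variable (G : NetGeneration n)

lemma exists_sum_abs_le : ∃ M : ℕ, ∀ s : G.states, ∑ i, |s.1 i| ≤ M := by
  obtain ⟨C, hC⟩ := (Set.finite_range fun s : G.states => ∑ i, |s.1 i|).bddAbove
  exact ⟨C.toNat, fun s => (hC ⟨s, rfl⟩).trans (Int.self_le_toNat C)⟩

lemma nextBattery_cast {bmax : ℕ} (σ : G.State bmax) (a : G.Action σ) :
    ((G.nextBattery σ a : ℕ) : ℝ) = (σ.2 : ℕ) + ((∑ i, a.1 i : ℤ) : ℝ) := by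
  have h := (mem_allowed.1 a.2).2.1
  have : ((G.nextBattery σ a : ℕ) : ℤ) = ((σ.2 : ℕ) : ℤ) + ∑ i, a.1 i := Int.toNat_of_nonneg h
  exact_mod_cast congrArg (Int.cast : ℤ → ℝ) this

/-- The free space of the battery, corrected by a function `g` of the net generation and shifted
by a bound `c` of `g`. With `g` a solution of the Poisson equation for the total net generation,
its drift is `-Δ` as long as no energy is spilled or lost. -/
noncomputable def freeSpace (g : G.states → ℝ) (c : ℝ) {bmax : ℕ} (σ : G.State bmax) : ℝ :=
  bmax - (σ.2 : ℕ) + (c - g σ.1)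

section Drift

variable {G} {g : G.states → ℝ} {c : ℝ} {bmax M : ℕ}

lemma sub_le_freeSpace (hg : ∀ s, |g s| ≤ c) (σ : G.State bmax) :
    (bmax : ℝ) - (σ.2 : ℕ) ≤ G.freeSpace g c σ := by
  have := (abs_le.1 (hg σ.1)).2
  unfold freeSpace
  linarith

lemma freeSpace_nonneg (hg : ∀ s, |g s| ≤ c) (σ : G.State bmax) : 0 ≤ G.freeSpace g c σ := by
  have h : ((σ.2 : ℕ) : ℝ) ≤ bmax := by exact_mod_cast Nat.lt_succ_iff.1 σ.2.2
  have := sub_le_freeSpace hg σ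
  linarith

lemma freeSpace_le (hg : ∀ s, |g s| ≤ c) (σ : G.State bmax) :
    G.freeSpace g c σ ≤ bmax - (σ.2 : ℕ) + 2 * c := by
  have := (abs_le.1 (hg σ.1)).1
  unfold freeSpace
  linarith

/-- Quadratic drift condition. Away from the full battery the free space decreases by at least
`Δ` on average, and near the full battery it is bounded. -/
lemma mean_freeSpace_sq_le {Δ : ℝ}
    (hpoisson : ∀ s, mean (G.trans s) g = g s - (((∑ i, s.1 i : ℤ) : ℝ) - Δ))
    (hg : ∀ s, |g s| ≤ c) (hM : ∀ s : G.states, ∑ i, |s.1 i| ≤ M)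
    (σ : G.State bmax) (a : G.Action σ)
    (ha : ∑ i, σ.1.1 i ≤ ∑ i, a.1 i ∨ bmax ≤ (σ.2 : ℕ) + M) :
    mean (G.trans σ.1) (fun x' => G.freeSpace g c (x', G.nextBattery σ a) ^ 2) ≤
      G.freeSpace g c σ ^ 2 - 2 * Δ * G.freeSpace g c σ +
        ((M + 2 * c) ^ 2 + 4 * M * (M + 2 * c)) := by
  have hZ0 := freeSpace_nonneg hg σ
  have hZle := freeSpace_le hg σ
  set Z := G.freeSpace g c σ with hZ
  set A : ℝ := ((∑ i, a.1 i : ℤ) : ℝ) with hA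
  set S : ℝ := ((∑ i, σ.1.1 i : ℤ) : ℝ) with hS
  have hAM : |A| ≤ M := by
    rw [hA, ← Int.cast_abs, ← Int.cast_natCast M]
    exact Int.cast_le.2 ((abs_sum_le_of_mem_allowed a.2).trans (hM σ.1))
  have hSM : |S| ≤ M := by
    rw [hS, ← Int.cast_abs, ← Int.cast_natCast M]
    exact Int.cast_le.2 ((Finset.abs_sum_le_sum_abs _ _).trans (hM σ.1))
  rw [abs_le] at hAM hSM
  have hgσ := abs_le.1 (hg σ.1)
  have hM0 : (0 : ℝ) ≤ M := Nat.cast_nonneg M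
  have hpt : ∀ x', G.freeSpace g c (x', G.nextBattery σ a) ^ 2 ≤
      (Z ^ 2 - 2 * Z * (A - g σ.1) + (M + 2 * c) ^ 2) - 2 * Z * g x' := by
    intro x'
    have hgx := abs_le.1 (hg x')
    have hD : (A + g x' - g σ.1) ^ 2 ≤ (M + 2 * c) ^ 2 := by
      apply sq_le_sq' <;> linarith
    have hnext : G.freeSpace g c (x', G.nextBattery σ a) = Z - (A + g x' - g σ.1) := by
      simp only [hZ, freeSpace, nextBattery_cast]
      ring
    rw [hnext]
    linarith
  refine (mean_mono _ hpt).trans ?_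
  rw [mean_sub, mean_const, mean_const_mul, hpoisson]
  have hkey : Z * (S - A) ≤ 2 * M * (M + 2 * c) := by
    rcases ha with h | h
    · have h' : S ≤ A := Int.cast_le.2 h
      have : Z * (S - A) ≤ 0 := mul_nonpos_of_nonneg_of_nonpos hZ0 (by linarith)
      have : 0 ≤ 2 * M * (M + 2 * c) := mul_nonneg (by linarith) (by linarith)
      linarith
    · have h' : (bmax : ℝ) ≤ (σ.2 : ℕ) + M := by exact_mod_cast h
      have h1 : Z * (S - A) ≤ Z * (2 * M) := mul_le_mul_of_nonneg_left (by linarith) hZ0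
      have h2 : Z * (2 * M) ≤ (M + 2 * c) * (2 * M) :=
        mul_le_mul_of_nonneg_right (by linarith) (by linarith)
      linarith
  linarith

end Drift

/-- The optimal loss of load rate is at most inversely proportional to the battery capacity. -/
lemma exists_LLRe_le {π : PMF G.states} (hπ : G.IsStationary π) (hΔ : 0 < G.systemDrift π) :
    ∃ (C : ℝ) (M : ℕ), ∀ bmax : ℕ, 2 * M < bmax → ∀ ν : PMF (G.State bmax),
      G.LLRe ν ≤ ENNReal.ofReal (C / (bmax - M)) := by
  obtain ⟨M, hM⟩ := G.exists_sum_abs_le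
  obtain ⟨g, hg⟩ := exists_poisson G.irreducible hπ fun s => ∑ i, (s.1 i : ℝ)
  rw [← G.systemDrift_eq_mean] at hg
  set Δ := G.systemDrift π
  obtain ⟨c, hc⟩ : ∃ c, ∀ s, |g s| ≤ c := by
    obtain ⟨c, hc⟩ := (Set.finite_range fun s => |g s|).bddAbove
    exact ⟨c, fun s => hc ⟨s, rfl⟩⟩
  have hpoisson : ∀ s : G.states,
      mean (G.trans s) g = g s - (((∑ i, s.1 i : ℤ) : ℝ) - Δ) := fun s => by
    rw [hg s]; push_cast; rfl
  set K : ℝ := (M + 2 * c) ^ 2 + 4 * M * (M + 2 * c) with hK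
  refine ⟨M * (1 + 2 * K) / (2 * Δ), M, fun bmax hb ν => ?_⟩
  have hbM : (0 : ℝ) < bmax - M := by
    have : (2 * M : ℝ) < bmax := by exact_mod_cast hb
    have : (0 : ℝ) ≤ M := Nat.cast_nonneg M
    linarith
  have hact : ∀ σ : G.State bmax, ∃ a : G.Action σ,
      (loss σ.1.1 a.1 = 0 ∨ (σ.2 : ℕ) < M) ∧
        (∑ i, σ.1.1 i ≤ ∑ i, a.1 i ∨ bmax ≤ (σ.2 : ℕ) + M) := fun σ => by
    obtain ⟨a, ha, h⟩ := exists_action (hM σ.1) hb.le (Nat.lt_succ_iff.1 σ.2.2)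
    exact ⟨⟨a, ha⟩, h⟩
  choose act hloss hspill using hact
  let φ : G.Policy bmax := fun t h => PMF.pure (act (h (Fin.last t)))
  refine (iInf_le _ φ).trans ?_
  set Z : G.State bmax → ℝ := G.freeSpace g c with hZ
  have hZ0 : ∀ σ, 0 ≤ Z σ := freeSpace_nonneg hc
  set V : ℕ → ℝ := fun t => mean (G.law ν φ t) fun h => Z (h (Fin.last t)) ^ 2 with hV
  set m : ℕ → ℝ := fun t => mean (G.law ν φ t) fun h => Z (h (Fin.last t)) with hm
  have hstep : ∀ t, V (t + 1) ≤ V t - 2 * Δ * m t + K := by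
    intro t
    simp only [hV, hm]
    rw [G.mean_law_succ ν φ (fun σ => Z σ ^ 2), ← mean_const_mul, ← mean_sub,
      ← mean_const (G.law ν φ t) K, ← mean_add]
    refine mean_mono _ fun h => ?_
    simp only [φ, mean_pure]
    exact mean_freeSpace_sq_le hpoisson hc hM _ _ (hspill _)
  have hsum : ∀ N : ℕ, V N + 2 * Δ * ∑ t ∈ Finset.range N, m t ≤ V 0 + N * K := by
    intro N
    induction N with
    | zero => simp
    | succ N ih =>
      rw [Finset.sum_range_succ]
      have := hstep N
      push_cast
      linarith
  have hVnn : ∀ t, 0 ≤ V t := fun t => le_mean_of_le _ fun h => sq_nonneg _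
  have hexp : ∀ t, G.expect ν φ (fun x a => (loss x a : ℝ)) t ≤ M / (bmax - M) * m t := by
    intro t
    simp only [hm]
    rw [expect_eq_mean, ← mean_const_mul]
    refine mean_mono _ fun h => ?_
    simp only [φ, mean_pure]
    set σ := h (Fin.last t)
    rcases hloss σ with h0 | h0
    · rw [h0, Int.cast_zero]
      exact mul_nonneg (div_nonneg (Nat.cast_nonneg M) hbM.le) (hZ0 σ)
    · have h1 : (loss σ.1.1 (act σ).1 : ℝ) ≤ M := by
        exact_mod_cast (loss_le_of_mem_allowed (act σ).2).trans (hM σ.1)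
      have h2 : (bmax : ℝ) - M ≤ Z σ := by
        have : ((σ.2 : ℕ) : ℝ) < M := by exact_mod_cast h0
        have := sub_le_freeSpace hc σ
        linarith
      rw [div_mul_eq_mul_div, le_div_iff₀ hbM]
      exact mul_le_mul h1 h2 hbM.le (Nat.cast_nonneg M)
  refine limsup_le_of_le (by isBoundedDefault) ?_
  have hKnn : 0 ≤ K := by
    obtain ⟨s, -⟩ := π.support_nonempty
    have : 0 ≤ c := (abs_nonneg _).trans (hc s)
    positivity
  -- the initial value `V 0` is absorbed once `V 0 ≤ T`
  filter_upwards [eventually_ge_atTop 1, eventually_ge_atTop ⌈V 0⌉₊] with T hT1 hT2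
  refine ENNReal.ofReal_le_ofReal ?_
  have hT1' : (1 : ℝ) ≤ T := by exact_mod_cast hT1
  have hT2' : V 0 ≤ T := Nat.ceil_le.1 hT2
  have hmT : ∑ t ∈ Finset.range (T + 1), m t ≤ T * (1 + 2 * K) / (2 * Δ) := by
    rw [le_div_iff₀ (by linarith)]
    have h1 := hsum (T + 1)
    have h2 := hVnn (T + 1)
    have h3 : K ≤ T * K := le_mul_of_one_le_left hKnn hT1'
    push_cast at h1
    linarith
  calc G.timeAverage ν φ (fun x a => (loss x a : ℝ)) T
      ≤ 1 / (T : ℝ) * (M / (bmax - M) * (T * (1 + 2 * K) / (2 * Δ))) := by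
        refine mul_le_mul_of_nonneg_left ?_ (by positivity)
        refine (Finset.sum_le_sum fun t _ => hexp t).trans ?_
        rw [← Finset.mul_sum]
        exact mul_le_mul_of_nonneg_left hmT (div_nonneg (Nat.cast_nonneg M) hbM.le)
    _ = M * (1 + 2 * K) / (2 * Δ) / (bmax - M) := by
        have : (T : ℝ) ≠ 0 := by positivity
        field_simp

lemma tendsto_LLRe {π : PMF G.states} (hπ : G.IsStationary π) (hΔ : 0 < G.systemDrift π)
    (ν : (bmax : ℕ) → PMF (G.State bmax)) :
    Tendsto (fun bmax => G.LLRe (ν bmax)) atTop (𝓝 0) := by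
  obtain ⟨C, M, h⟩ := G.exists_LLRe_le hπ hΔ
  have hlim : Tendsto (fun b : ℕ => ENNReal.ofReal (C / ((b : ℝ) - M))) atTop (𝓝 0) := by
    rw [← ENNReal.ofReal_zero]
    refine ENNReal.tendsto_ofReal (Tendsto.const_div_atTop ?_ C)
    exact tendsto_atTop_add_const_right _ (-(M : ℝ)) tendsto_natCast_atTop_atTop
  refine tendsto_of_tendsto_of_tendsto_of_le_of_le' tendsto_const_nhds hlim
    (Eventually.of_forall fun _ => zero_le) ?_
  filter_upwards [eventually_gt_atTop (2 * M)] with b hb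
  exact h b hb _

end NetGeneration

end BatterySharing

theorem lemma1 {n : ℕ} (G : BatterySharing.NetGeneration n) (π : PMF G.states)
    (hπ : G.IsStationary π)
    (hD : ∃ i, G.drift π i < 0) (hΔ : 0 < G.systemDrift π)
    (ν : (bmax : ℕ) → PMF (G.State bmax)) :
    Tendsto (fun bmax => G.PoF (ν bmax)) atTop (𝓝 ∞) ∧
      (∀ bmax, ENNReal.ofReal (∑ i with G.drift π i < 0, -G.drift π i) ≤ G.LLRo (ν bmax)) ∧
      Tendsto (fun bmax => G.LLRe (ν bmax)) atTop (𝓝 0) := by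
  have hfair : ∀ bmax,
      ENNReal.ofReal (∑ i with G.drift π i < 0, -G.drift π i) ≤ G.LLRo (ν bmax) :=
    fun bmax => le_iInf₂ fun φ hφ => G.le_LLR_of_isFair hπ hφ
  have hzero := G.tendsto_LLRe hπ hΔ ν
  refine ⟨?_, hfair, hzero⟩
  have hpos : 0 < ∑ i with G.drift π i < 0, -G.drift π i := by
    obtain ⟨i, hi⟩ := hD
    refine Finset.sum_pos (fun j hj => neg_pos.2 (Finset.mem_filter.1 hj).2)
      ⟨i, Finset.mem_filter.2 ⟨Finset.mem_univ i, hi⟩⟩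
  have hlim : Tendsto (fun bmax => ENNReal.ofReal (∑ i with G.drift π i < 0, -G.drift π i) /
      G.LLRe (ν bmax)) atTop (𝓝 ∞) := by
    have h := ENNReal.Tendsto.const_div hzero
      (a := ENNReal.ofReal (∑ i with G.drift π i < 0, -G.drift π i))
      (Or.inr ENNReal.ofReal_ne_top)
    rwa [ENNReal.div_zero (ENNReal.ofReal_pos.2 hpos).ne'] at h
  exact tendsto_of_tendsto_of_tendsto_of_le_of_le hlim tendsto_const_nhds
    (fun bmax => ENNReal.div_le_div_right (hfair bmax) _) fun _ => le_top
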